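/- Let $\Sigma$ be a nonempty finite alphabet, $\Sigma_\downarrow=\Sigma\cup\{\downarrow\}$, and define the active window of a stream $u\in\Sigma_\downarrow^*$ by $\mathrm{wnd}(\varepsilon)=\varepsilon$, $\mathrm{wnd}(ua)=\mathrm{wnd}(u)a$ for $a\in\Sigma$, and $\mathrm{wnd}(u{\downarrow})=v$ if $\mathrm{wnd}(u)=av$ with $a\in\Sigma$, $\mathrm{wnd}(u{\downarrow})=\varepsilon$ if $\mathrm{wnd}(u)=\varepsilon$. Let $\mathrm{mwl}(u)$ be the maximum of $|\mathrm{wnd}(u')|$ over all prefixes $u'$ of $u$. A randomized variable-size sliding-window algorithm $\mathcal P$ for $L\subseteq\Sigma^*$ is a probabilistic automaton over $\Sigma_\downarrow$ (with an arbitrary, possibly infinite, nonempty state set $Q$, an initial distribution on $Q$, transition probabilities, and a set of final states) such that for every $u\in\Sigma_\downarrow^*$, after reading $u$, the state is final with probability at least $2/3$ if $\mathrm{wnd}(u)\in L$, and non-final with probability at least $2/3$ if $\mathrm{wnd}(u)\notin L$. Its space complexity is $v(\mathcal P,n)=\log_2|M_{\le n}|\in\mathbb R_{\ge0}\cup\{\infty\}$,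 where $M_{\le n}$ is the set of states reached with nonzero probability on some stream $u$ with $\mathrm{mwl}(u)\le n$. A deterministic variable-size sliding-window algorithm for $L$ is a deterministic automaton (possibly with infinitely many states) that accepts exactly the streams $u$ with $\mathrm{wnd}(u)\in L$; $v(\mathcal P,n)$ is defined in the same way. (1) If $\emptyset\subsetneq L\subsetneq\Sigma^*$ is any language, then every randomized variable-size sliding-window algorithm $\mathcal P$ for $L$ satisfies $v(\mathcal P,n)=\Omega(\log n)$. (2) Randomized variable-size algorithms show the same space trichotomy as deterministic ones. Let $L\subseteq\Sigma^*$ be regular, and let $\langle\mathbf{LI},\mathbf{Len}\rangle$ be the class of finite Boolean combinations of regular left ideals $\Sigma^*K$ ($K\subseteq\Sigma^*$ regular) and regular length languages (regular $K$ such that for all $n$, $\Sigma^n\subseteq K$ or $\Sigma^n\cap K=\emptyset$). Then, both for randomized and for deterministic variable-size sliding-window algorithms: - if $L\in\{\emptyset,\Sigma^*\}$, then some algorithm for $L$ satisfies $v(\mathcal P,n)=O(1)$; - if $L\notin\{\emptyset,\Sigma^*\}$ and $L\in\langle\mathbf{LI},\mathbf{Len}\rangle$, then some algorithm for $L$ satisfies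 $v(\mathcal P,n)=O(\log n)$, and every algorithm for $L$ satisfies $v(\mathcal P,n)=\Omega(\log n)$; - if $L\notin\langle\mathbf{LI},\mathbf{Len}\rangle$, then some algorithm for $L$ satisfies $v(\mathcal P,n)=O(n)$, and every algorithm for $L$ satisfies $v(\mathcal P,n)=\Omega(n)$. In all lower bounds the constants hidden in $\Omega$ (factor and threshold) depend only on $L$, not on $\mathcal P$. -/

import Mathlib

open scoped ENNReal

universe u v

namespace SlidingWindow

noncomputable section

/-! ### The variable-size sliding window problem

A stream over the extended alphabet is a list over `Option α`: the letter `some a` appends `a` to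
the window, and `none` is the pop operation. -/

/-- One update of the active window. Popping the empty window leaves it empty. -/
def windowStep {α : Type u} (w : List α) : Option α → List α
  | some a => w ++ [a]
  | none => w.tail

/-- The active window after reading a stream. -/
def window {α : Type u} (x : List (Option α)) : List α :=
  x.foldl windowStep []

/-- The maximum length of the active window, over all prefixes of the stream. -/
def maxWindowLength {α : Type u} (x : List (Option α)) : ℕ :=
  (Finset.range (x.length + 1)).sup fun i => (window (x.take i)).length

/-- The variable-size sliding window problem of `L`: all streams whose active window is in `L`. -/
def SW {α : Type u} (L : Language α) : Language (Option α) :=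
  {x : List (Option α) | window x ∈ L}

/-! ### Streaming algorithms -/

/-- A randomized streaming algorithm (probabilistic automaton) over the alphabet `β`, with a
possibly infinite set `Q` of memory states. -/
structure RandAlg (β : Type u) (Q : Type v) where
  /-- The initial state distribution. -/
  init : PMF Q
  /-- The transition probabilities. -/
  step : Q → β → PMF Q
  /-- The final states. -/
  accept : Set Q

/-- The distribution of the memory state after reading a word. -/
def RandAlg.run {β : Type u} {Q : Type v} (P : RandAlg β Q) (x : List β) : PMF Q :=
  x.foldl (fun μ b => μ.bind fun q => P.step q b) P.init

/-- `P` is a randomized streaming algorithm for the language `K` with two-sided error `err`. -/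
def RandAlg.IsFor {β : Type u} {Q : Type v} (P : RandAlg β Q) (K : Language β) (err : ℝ≥0∞) :
    Prop :=
  (∀ x ∈ K, 1 - err ≤ (P.run x).toOuterMeasure P.accept) ∧
    (∀ x ∉ K, 1 - err ≤ (P.run x).toOuterMeasure P.acceptᶜ)

/-- A randomized variable-size sliding window algorithm for `L` (with error `1/3`). -/
def IsRandSWAlg {α : Type u} {Q : Type v} (P : RandAlg (Option α) Q) (L : Language α) : Prop :=
  P.IsFor (SW L) (1 / 3)

/-- A deterministic variable-size sliding window algorithm for `L`. Mathlib's `DFA` does not ask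
for finitely many states, so it is a deterministic streaming algorithm. -/
def IsDetSWAlg {α : Type u} {Q : Type v} (P : DFA (Option α) Q) (L : Language α) : Prop :=
  P.accepts = SW L

/-! ### Space complexity -/

/-- The number `log₂ |S|` of bits needed for storing an element of `S`; infinite if `S` is. -/
def bits {Q : Type v} (S : Set Q) : ℝ≥0∞ :=
  open Classical in
  if S.Finite then ENNReal.ofReal (Real.logb 2 S.ncard) else ⊤

/-- The space complexity `v(P, n)` of a randomized algorithm: the number of bits needed for the
memory states that are reached with nonzero probability on some stream whose window length never
exceeds `n`. -/
def randSpace {α : Type u} {Q : Type v} (P : RandAlg (Option α) Q) (n : ℕ) : ℝ≥0∞ :=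
  bits {q : Q | ∃ x : List (Option α), maxWindowLength x ≤ n ∧ q ∈ (P.run x).support}

/-- The space complexity `v(P, n)` of a deterministic algorithm. -/
def detSpace {α : Type u} {Q : Type v} (P : DFA (Option α) Q) (n : ℕ) : ℝ≥0∞ :=
  bits {q : Q | ∃ x : List (Option α), maxWindowLength x ≤ n ∧ q = P.eval x}

/-- `f = O(g)`. -/
def IsBigO (f : ℕ → ℝ≥0∞) (g : ℕ → ℝ) : Prop :=
  ∃ C : ℝ, 0 < C ∧ ∃ n₀ : ℕ, ∀ n ≥ n₀, f n ≤ ENNReal.ofReal (C * g n)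

/-- Some randomized variable-size sliding window algorithm for `L` uses `O(g)` bits. -/
def RandUpper {α : Type u} (L : Language α) (g : ℕ → ℝ) : Prop :=
  ∃ (Q : Type u) (P : RandAlg (Option α) Q), IsRandSWAlg P L ∧ IsBigO (randSpace P) g

/-- Every randomized variable-size sliding window algorithm for `L` uses `Ω(g)` bits,
where the constants in `Ω` depend only on `L`. -/
def RandLower {α : Type u} (L : Language α) (g : ℕ → ℝ) : Prop :=
  ∃ c : ℝ, 0 < c ∧ ∃ n₀ : ℕ, ∀ (Q : Type v) (P : RandAlg (Option α) Q), IsRandSWAlg P L →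
    ∀ n ≥ n₀, ENNReal.ofReal (c * g n) ≤ randSpace P n

/-- Some deterministic variable-size sliding window algorithm for `L` uses `O(g)` bits. -/
def DetUpper {α : Type u} (L : Language α) (g : ℕ → ℝ) : Prop :=
  ∃ (Q : Type u) (P : DFA (Option α) Q), IsDetSWAlg P L ∧ IsBigO (detSpace P) g

/-- Every deterministic variable-size sliding window algorithm for `L` uses `Ω(g)` bits,
where the constants in `Ω` depend only on `L`. -/
def DetLower {α : Type u} (L : Language α) (g : ℕ → ℝ) : Prop :=
  ∃ c : ℝ, 0 < c ∧ ∃ n₀ : ℕ, ∀ (Q : Type v) (P : DFA (Option α) Q), IsDetSWAlg P L →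
    ∀ n ≥ n₀, ENNReal.ofReal (c * g n) ≤ detSpace P n

/-! ### Classes of regular languages -/

/-- The regular left ideals `Σ* K` with `K` regular. -/
def LI (α : Type u) : Set (Language α) :=
  {L | ∃ K : Language α, K.IsRegular ∧ L = ⊤ * K}

/-- The regular length languages: each `Σⁿ` is contained in the language or disjoint from it. -/
def Len (α : Type u) : Set (Language α) :=
  {L | L.IsRegular ∧ ∀ n : ℕ, (∀ w : List α, w.length = n → w ∈ L) ∨
    (∀ w : List α, w.length = n → w ∉ L)}

/-- The finite Boolean combinations of regular left ideals and regular length languages. -/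
def LILen (α : Type u) : Set (Language α) :=
  BooleanSubalgebra.closure (LI α ∪ Len α)

end

end SlidingWindow

/-! A randomized algorithm for `L` must answer every query, whether the window is in `L` after the
updates `y`, correctly with probability `2/3`. If the windows of length at most `n` are shattered to
depth `d` by such queries, an adversary walks down the binary tree of queries: it discounts the
weight of each memory state by the expected log-likelihood of its answers, and always follows the
outcome that at least halves the total weight. By Jensen's inequality every level of the tree then
costs `1 - H(1/3)` bits.

For `L` different from `∅` and `Σ*` there are a letter and a word such that prepending the letter
changes membership in `L`, so that queries can find by binary search how many letters remain in the
window; this gives depth `Ω(log n)`. For regular `L`, take a finite automaton for the reversal of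
`L`. If two loops of the same length at a state `p` disagree about acceptance after the same number
of letters, then products of `k` such loops are shattered to depth `k`, which gives depth `Ω(n)`.
If there are no such loops, then whether a window is in `L` is determined by its length modulo some
`N` and by the strongly connected component in which its reversal ends, provided one knows some
state visited there at a length in the same residue class; left ideals and length languages can
express this. Conversely, a left ideal is maintained by storing, for each state of the automaton,
the length of the shortest suffix of the window leading to it, which takes `O(log n)` bits. -/

namespace SlidingWindow

/-! ### Adaptive shattering -/

section Shattering

variable {ι κ τ υ Q : Type*} {R : ι → τ → Prop} {d : ℕ} {X : Set ι}

/-- `Shatters R d X` says that the Littlestone dimension of `X` with respect to the tests `R · y`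
is at least `d`: there is a complete binary tree of depth `d` whose inner nodes carry tests and all
of whose branches are realized by elements of `X`. The two subtrees of a node are indexed by the
outcome `b` of its test, a truth value. -/
def Shatters (R : ι → τ → Prop) : ℕ → Set ι → Prop
  | 0, X => X.Nonempty
  | d + 1, X => ∃ y, ∀ b : Prop, Shatters R d {x ∈ X | R x y ↔ b}

theorem Shatters.map {S : κ → υ → Prop} {Y : Set κ} {f : ι → κ} (h : Shatters R d X)
    (hf : Set.MapsTo f X Y) (hRS : ∀ y, ∃ z, ∀ x ∈ X, S (f x) z ↔ R x y) : Shatters S d Y := by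
  induction d generalizing X Y with
  | zero => exact (Set.Nonempty.image f h).mono hf.image_subset
  | succ d ih =>
    obtain ⟨y, hy⟩ := h
    obtain ⟨z, hz⟩ := hRS y
    refine ⟨z, fun b => ih (hy b) (fun x hx => ⟨hf hx.1, (hz x hx.1).trans hx.2⟩) fun y' => ?_⟩
    obtain ⟨z', hz'⟩ := hRS y'
    exact ⟨z', fun x hx => hz' x hx.1⟩

theorem Shatters.mono {Y : Set ι} (h : Shatters R d X) (hXY : X ⊆ Y) : Shatters R d Y :=
  h.map (f := id) hXY fun y => ⟨y, fun _ _ => Iff.rfl⟩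

/-- The probability of answering `b` correctly when accepting with probability `a`. -/
noncomputable def correctProb (b : Prop) (a : ℝ) : ℝ :=
  open Classical in if b then a else 1 - a

/-- The expected logarithm of the likelihood of an answer which is correct with probability `s`,
under the hypothesis that answers are wrong with probability `ε`. -/
noncomputable def logLikelihood (ε s : ℝ) : ℝ :=
  s * Real.log (1 - ε) + (1 - s) * Real.log ε

theorem logLikelihood_one_sub_self (ε : ℝ) : logLikelihood ε (1 - ε) = -Real.binEntropy ε := by
  simp only [logLikelihood, Real.binEntropy, Real.log_inv]
  ring

theorem monotone_logLikelihood {ε : ℝ} (hε₀ : 0 < ε) (hε : ε ≤ 1 / 2) :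
    Monotone (logLikelihood ε) := by
  intro s t hst
  have hlog : Real.log ε ≤ Real.log (1 - ε) := Real.log_le_log hε₀ (by linarith)
  unfold logLikelihood
  nlinarith

theorem exp_logLikelihood_le {ε s : ℝ} (hε₀ : 0 < ε) (hε₁ : ε < 1) (hs : s ∈ Set.Icc 0 1) :
    Real.exp (logLikelihood ε s) ≤ s * (1 - ε) + (1 - s) * ε := by
  have h := convexOn_exp.2 (Set.mem_univ (Real.log (1 - ε))) (Set.mem_univ (Real.log ε))
    hs.1 (sub_nonneg.2 hs.2) (add_sub_cancel s 1)
  rwa [Real.exp_log (sub_pos.2 hε₁), Real.exp_log hε₀] at h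

theorem sum_mul_logLikelihood (S : Finset Q) {p : Q → ℝ} (hp : ∑ q ∈ S, p q = 1) (ε : ℝ)
    (s : Q → ℝ) :
    ∑ q ∈ S, p q * logLikelihood ε (s q) = logLikelihood ε (∑ q ∈ S, p q * s q) := by
  have hp' : ∑ q ∈ S, p q * (1 - s q) = 1 - ∑ q ∈ S, p q * s q := by
    simp only [mul_one_sub, Finset.sum_sub_distrib, hp]
  simp only [logLikelihood, mul_add, Finset.sum_add_distrib, ← mul_assoc, ← Finset.sum_mul, hp']

/-- The two outcomes of a test share the weight of every `q`, so one gets at most half of it. -/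
theorem exists_outcome_two_mul_sum_exp_le {ε : ℝ} (hε₀ : 0 < ε) (hε₁ : ε < 1) (S : Finset Q)
    {a : Q → ℝ} (ha : ∀ q, a q ∈ Set.Icc 0 1) (w : Q → ℝ) :
    ∃ b : Prop, 2 * ∑ q ∈ S, Real.exp (w q + logLikelihood ε (correctProb b (a q))) ≤
      ∑ q ∈ S, Real.exp (w q) := by
  by_contra! h
  have htrue := h True
  have hfalse := h False
  simp only [correctProb, if_true, if_false, Real.exp_add] at htrue hfalse
  have hadd : ∑ q ∈ S, Real.exp (w q) * Real.exp (logLikelihood ε (a q)) +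
      ∑ q ∈ S, Real.exp (w q) * Real.exp (logLikelihood ε (1 - a q)) ≤
        ∑ q ∈ S, Real.exp (w q) := by
    rw [← Finset.sum_add_distrib]
    refine Finset.sum_le_sum fun q _ => ?_
    have haccept := exp_logLikelihood_le hε₀ hε₁ (ha q)
    have hreject := exp_logLikelihood_le hε₀ hε₁ (s := 1 - a q)
      ⟨sub_nonneg.2 (ha q).2, sub_le_self 1 (ha q).1⟩
    rw [← mul_add]
    exact mul_le_of_le_one_right (Real.exp_pos _).le (by linarith)
  linarith

/-- The adversary walks down the tree, always to the outcome that at least halves the weight. -/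
theorem Shatters.exists_two_pow_mul_sum_exp_le {ε : ℝ} (hε₀ : 0 < ε) (hε₁ : ε < 1)
    (S : Finset Q) {a : Q → τ → ℝ} (ha : ∀ q y, a q y ∈ Set.Icc 0 1) (h : Shatters R d X)
    (w : Q → ℝ) :
    ∃ x ∈ X, ∃ ys : List τ, ys.length = d ∧
      2 ^ d * ∑ q ∈ S, Real.exp
        (w q + (ys.map fun y => logLikelihood ε (correctProb (R x y) (a q y))).sum) ≤
          ∑ q ∈ S, Real.exp (w q) := by
  induction d generalizing X w with
  | zero =>
    obtain ⟨x, hx⟩ := h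
    exact ⟨x, hx, [], rfl, by simp⟩
  | succ d ih =>
    obtain ⟨y, hy⟩ := h
    obtain ⟨b, hb⟩ := exists_outcome_two_mul_sum_exp_le hε₀ hε₁ S (fun q => ha q y) w
    obtain ⟨x, ⟨hx, hxb⟩, ys, rfl, hle⟩ :=
      ih (hy b) fun q => w q + logLikelihood ε (correctProb b (a q y))
    refine ⟨x, hx, y :: ys, rfl, ?_⟩
    simp only [List.map_cons, List.sum_cons, hxb, ← add_assoc]
    rw [pow_succ', mul_assoc]
    linarith

end Shattering

/-! ### The memory of randomized automata -/

section Probability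

variable {Q : Type*} (μ : PMF Q) {S : Finset Q}

theorem toOuterMeasure_le_one (A : Set Q) : μ.toOuterMeasure A ≤ 1 := by
  let _ : MeasurableSpace Q := ⊤
  rw [← PMF.toMeasure_apply_eq_toOuterMeasure]
  exact MeasureTheory.prob_le_one

theorem toOuterMeasure_ne_top (A : Set Q) : μ.toOuterMeasure A ≠ ∞ :=
  ne_top_of_le_ne_top ENNReal.one_ne_top (toOuterMeasure_le_one μ A)

theorem toReal_toOuterMeasure_compl (A : Set Q) :
    (μ.toOuterMeasure Aᶜ).toReal = 1 - (μ.toOuterMeasure A).toReal := by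
  let _ : MeasurableSpace Q := ⊤
  simp only [← PMF.toMeasure_apply_eq_toOuterMeasure]
  exact MeasureTheory.probReal_compl_eq_one_sub (MeasurableSpace.measurableSet_top (s := A))

variable {μ}

theorem sum_toReal_eq_one (hS : μ.support ⊆ S) : ∑ q ∈ S, (μ q).toReal = 1 := by
  rw [← ENNReal.toReal_sum fun q _ => μ.apply_ne_top q, ← μ.toOuterMeasure_apply_finset,
    (μ.toOuterMeasure_apply_eq_one_iff _).2 hS, ENNReal.toReal_one]

theorem toReal_toOuterMeasure_bind {Q' : Type*} (hS : μ.support ⊆ S) (f : Q → PMF Q')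
    (A : Set Q') :
    ((μ.bind f).toOuterMeasure A).toReal =
      ∑ q ∈ S, (μ q).toReal * ((f q).toOuterMeasure A).toReal := by
  have hsupp : ∀ q ∉ S, μ q * (f q).toOuterMeasure A = 0 := fun q hq => by
    rw [(μ.apply_eq_zero_iff q).2 fun h => hq (hS h), zero_mul]
  rw [PMF.toOuterMeasure_bind_apply, tsum_eq_sum hsupp, ENNReal.toReal_sum fun q _ =>
    ENNReal.mul_ne_top (μ.apply_ne_top q) (toOuterMeasure_ne_top (f q) A)]
  simp only [ENNReal.toReal_mul]

theorem sum_mul_correctProb {p : Q → ℝ} (hp : ∑ q ∈ S, p q = 1) (b : Prop) (a : Q → ℝ) :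
    ∑ q ∈ S, p q * correctProb b (a q) = correctProb b (∑ q ∈ S, p q * a q) := by
  by_cases hb : b <;> simp [correctProb, hb, mul_one_sub, Finset.sum_sub_distrib, hp]

theorem length_mul_le_sum_mul_sum_map {τ : Type*} {p : Q → ℝ} {f : Q → τ → ℝ} {c : ℝ}
    (ys : List τ) (h : ∀ y, c ≤ ∑ q ∈ S, p q * f q y) :
    ys.length * c ≤ ∑ q ∈ S, p q * (ys.map (f q)).sum := by
  induction ys with
  | nil => simp
  | cons y ys ih =>
    simp only [List.length_cons, List.map_cons, List.sum_cons, mul_add, Finset.sum_add_distrib]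
    push_cast
    linarith [h y]

end Probability

section RandAlg

variable {β Q : Type*} {P : RandAlg β Q} {K : Language β} {ε : ℝ}

/-- The distribution of the memory state after reading a word, starting in the state `q`. -/
noncomputable def RandAlg.runFrom (P : RandAlg β Q) (q : Q) (x : List β) : PMF Q :=
  x.foldl (fun μ b => μ.bind fun q => P.step q b) (PMF.pure q)

theorem RandAlg.run_append (P : RandAlg β Q) (x y : List β) :
    P.run (x ++ y) = (P.run x).bind fun q => P.runFrom q y := by
  unfold RandAlg.run RandAlg.runFrom
  rw [List.foldl_append]
  generalize x.foldl _ P.init = μ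
  induction y using List.reverseRecOn with
  | nil => simp only [List.foldl_nil, PMF.bind_pure]
  | append_singleton y b ih => simp only [List.foldl_append, ih, List.foldl_cons, List.foldl_nil,
      PMF.bind_bind]

/-- The probability of acceptance after reading `y` from the state `q`. -/
noncomputable def RandAlg.acceptProb (P : RandAlg β Q) (q : Q) (y : List β) : ℝ :=
  ((P.runFrom q y).toOuterMeasure P.accept).toReal

theorem RandAlg.acceptProb_mem_Icc (P : RandAlg β Q) (q : Q) (y : List β) :
    P.acceptProb q y ∈ Set.Icc 0 1 :=
  ⟨ENNReal.toReal_nonneg, ENNReal.toReal_le_of_le_ofReal zero_le_one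
    (by simpa only [ENNReal.ofReal_one] using toOuterMeasure_le_one _ P.accept)⟩

theorem RandAlg.IsFor.one_sub_le_correctProb (hε : 0 ≤ ε) (hP : P.IsFor K (ENNReal.ofReal ε))
    (x : List β) :
    1 - ε ≤ correctProb (x ∈ K) ((P.run x).toOuterMeasure P.accept).toReal := by
  have htoReal : ∀ A, 1 - ENNReal.ofReal ε ≤ (P.run x).toOuterMeasure A →
      1 - ε ≤ ((P.run x).toOuterMeasure A).toReal := fun A hA => by
    rwa [← ENNReal.ofReal_one, ← ENNReal.ofReal_sub 1 hε,
      ENNReal.ofReal_le_iff_le_toReal (toOuterMeasure_ne_top _ A)] at hA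
  by_cases hx : x ∈ K
  · simpa only [correctProb, hx, if_true] using htoReal _ (hP.1 x hx)
  · simpa only [correctProb, hx, if_false, toReal_toOuterMeasure_compl] using htoReal _ (hP.2 x hx)

theorem RandAlg.IsFor.neg_binEntropy_le_sum (hε₀ : 0 < ε) (hε : ε ≤ 1 / 2)
    (hP : P.IsFor K (ENNReal.ofReal ε)) {S : Finset Q} {x : List β}
    (hS : (P.run x).support ⊆ S) (y : List β) :
    -Real.binEntropy ε ≤ ∑ q ∈ S, (P.run x q).toReal *
      logLikelihood ε (correctProb (x ++ y ∈ K) (P.acceptProb q y)) := by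
  have hsum := sum_toReal_eq_one hS
  rw [sum_mul_logLikelihood S hsum, sum_mul_correctProb hsum, ← logLikelihood_one_sub_self]
  refine monotone_logLikelihood hε₀ hε ?_
  simpa only [RandAlg.acceptProb, RandAlg.run_append, toReal_toOuterMeasure_bind hS] using
    hP.one_sub_le_correctProb hε₀.le (x ++ y)

/-- By Jensen's inequality the weight left to the adversary is at least `exp (-d * H ε)`. -/
theorem Shatters.mul_le_log_card {d : ℕ} {X : Set (List β)} (hε₀ : 0 < ε) (hε : ε ≤ 1 / 2)
    (hP : P.IsFor K (ENNReal.ofReal ε)) {S : Finset Q} (hS : ∀ x ∈ X, (P.run x).support ⊆ S)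
    (h : Shatters (fun x y => x ++ y ∈ K) d X) :
    d * (Real.log 2 - Real.binEntropy ε) ≤ Real.log S.card := by
  obtain ⟨x, hx, ys, rfl, hle⟩ := h.exists_two_pow_mul_sum_exp_le hε₀ (by linarith) S
    P.acceptProb_mem_Icc fun _ => 0
  set g : Q → ℝ := fun q => (ys.map fun y =>
    logLikelihood ε (correctProb (x ++ y ∈ K) (P.acceptProb q y))).sum
  have hp := sum_toReal_eq_one (hS x hx)
  have hentropy : ys.length * -Real.binEntropy ε ≤ ∑ q ∈ S, (P.run x q).toReal * g q :=
    length_mul_le_sum_mul_sum_map ys fun y => hP.neg_binEntropy_le_sum hε₀ hε (hS x hx) y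
  have hjensen : Real.exp (ys.length * -Real.binEntropy ε) ≤ ∑ q ∈ S, Real.exp (g q) := by
    calc Real.exp (ys.length * -Real.binEntropy ε)
        ≤ Real.exp (∑ q ∈ S, (P.run x q).toReal • g q) := Real.exp_le_exp.2 hentropy
      _ ≤ ∑ q ∈ S, (P.run x q).toReal • Real.exp (g q) :=
        convexOn_exp.map_sum_le (fun _ _ => ENNReal.toReal_nonneg) hp fun _ _ => Set.mem_univ _
      _ ≤ ∑ q ∈ S, Real.exp (g q) := Finset.sum_le_sum fun q _ =>
        mul_le_of_le_one_left (Real.exp_pos _).le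
          (ENNReal.toReal_le_of_le_ofReal zero_le_one (by simpa using (P.run x).coe_le_one q))
  have hcard : 2 ^ ys.length * Real.exp (ys.length * -Real.binEntropy ε) ≤ S.card := by
    simp only [zero_add, Real.exp_zero, Finset.sum_const, nsmul_eq_mul, mul_one] at hle
    exact (mul_le_mul_of_nonneg_left hjensen (by positivity)).trans hle
  have hlog := Real.log_le_log (by positivity) hcard
  rw [Real.log_mul (by positivity) (by positivity), Real.log_pow, Real.log_exp] at hlog
  linarith

end RandAlg

/-! ### Windows -/

section Window

variable {α : Type u} {L : Language α}

theorem window_append (x y : List (Option α)) :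
    window (x ++ y) = y.foldl windowStep (window x) :=
  List.foldl_append

theorem foldl_windowStep_map_some (v w : List α) :
    (w.map some).foldl windowStep v = v ++ w := by
  induction w generalizing v with
  | nil => simp
  | cons a w ih => simp [ih, windowStep]

theorem foldl_windowStep_replicate_none (v : List α) (k : ℕ) :
    (List.replicate k none).foldl windowStep v = v.drop k := by
  induction k generalizing v with
  | zero => simp
  | succ k ih => simp [List.replicate_succ, ih, windowStep, List.drop_tail]

theorem window_map_some (w : List α) : window (w.map some) = w :=
  foldl_windowStep_map_some [] w

theorem maxWindowLength_map_some_le (w : List α) :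
    maxWindowLength (w.map some) ≤ w.length := by
  refine Finset.sup_le fun i _ => ?_
  rw [← List.map_take, window_map_some]
  exact List.length_take_le' i w

theorem length_window_le (x : List (Option α)) : (window x).length ≤ maxWindowLength x := by
  simpa only [maxWindowLength, List.take_length] using
    Finset.le_sup (f := fun i => (window (x.take i)).length) (Finset.self_mem_range_succ x.length)

/-- The test on windows given by `t = (k, v)`: is the window in `L` after `k` pops followed by
pushing `v`? -/
def windowTest (L : Language α) (w : List α) (t : ℕ × List α) : Prop :=
  w.drop t.1 ++ t.2 ∈ L

theorem Shatters.map_some_image {d : ℕ} {W : Set (List α)} (h : Shatters (windowTest L) d W) :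
    Shatters (fun x y => x ++ y ∈ SW L) d (List.map some '' W) := by
  refine h.map (Set.mapsTo_image _ W) fun t =>
    ⟨List.replicate t.1 none ++ t.2.map some, fun w _ => ?_⟩
  change window _ ∈ L ↔ _
  rw [window_append, window_map_some, List.foldl_append, foldl_windowStep_replicate_none,
    foldl_windowStep_map_some, windowTest]

theorem ofReal_le_randSpace_of_shatters {Q : Type*} {P : RandAlg (Option α) Q} {ε : ℝ}
    (hε₀ : 0 < ε) (hε : ε ≤ 1 / 2) (hP : P.IsFor (SW L) (ENNReal.ofReal ε)) {n d : ℕ}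
    {W : Set (List α)} (hW : ∀ w ∈ W, w.length ≤ n) (h : Shatters (windowTest L) d W) :
    ENNReal.ofReal (d * (1 - Real.binEntropy ε / Real.log 2)) ≤ randSpace P n := by
  unfold randSpace bits
  split_ifs with hfin
  · have hcard := h.map_some_image.mul_le_log_card hε₀ hε hP (S := hfin.toFinset) (by
      rintro _ ⟨w, hw, rfl⟩ q hq
      exact hfin.mem_toFinset.2 ⟨_, (maxWindowLength_map_some_le w).trans (hW w hw), hq⟩)
    have hlog : 0 < Real.log 2 := Real.log_pos one_lt_two
    rw [Set.ncard_eq_toFinset_card _ hfin, ← Real.log_div_log]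
    refine ENNReal.ofReal_le_ofReal ((le_div_iff₀ hlog).2 (hcard.trans' (le_of_eq ?_)))
    field_simp
  · exact le_top

theorem randLower_of_shatters {g : ℕ → ℝ} {c : ℝ} (hc : 0 < c) {n₀ : ℕ}
    (h : ∀ n ≥ n₀, ∃ (d : ℕ) (W : Set (List α)), (∀ w ∈ W, w.length ≤ n) ∧
      Shatters (windowTest L) d W ∧ c * g n ≤ d) :
    RandLower.{u, v} L g := by
  have hentropy : 0 < 1 - Real.binEntropy (1 / 3) / Real.log 2 :=
    sub_pos.2 ((div_lt_one (Real.log_pos one_lt_two)).2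
      (Real.binEntropy_lt_log_two.2 (by norm_num)))
  refine ⟨c * (1 - Real.binEntropy (1 / 3) / Real.log 2), mul_pos hc hentropy, n₀,
    fun Q P hP n hn => ?_⟩
  obtain ⟨d, W, hW, hs, hd⟩ := h n hn
  have hP' : P.IsFor (SW L) (ENNReal.ofReal (1 / 3)) := by
    rwa [ENNReal.ofReal_div_of_pos three_pos, ENNReal.ofReal_one, ENNReal.ofReal_ofNat]
  refine le_trans (ENNReal.ofReal_le_ofReal ?_)
    (ofReal_le_randSpace_of_shatters (by norm_num) (by norm_num) hP' hW hs)
  rw [mul_right_comm]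
  exact mul_le_mul_of_nonneg_right hd hentropy.le

end Window

/-! ### Nontrivial languages need logarithmic space -/

section Logarithmic

theorem exists_card_filter_le_eq {ι : Type*} [LinearOrder ι] {D : Finset ι} {m : ℕ} (hm : 0 < m)
    (hD : m ≤ D.card) : ∃ t, {j ∈ D | j ≤ t}.card = m := by
  let e := D.orderEmbOfFin rfl
  let i : Fin D.card := ⟨m - 1, by omega⟩
  refine ⟨e i, ?_⟩
  have hfilter : {j ∈ D | j ≤ e i} = (Finset.Iic i).map e.toEmbedding := by
    ext j
    have hj : j ∈ D ↔ ∃ k, e k = j := by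
      rw [← Finset.mem_coe, ← D.range_orderEmbOfFin rfl, Set.mem_range]
    simp only [Finset.mem_filter, Finset.mem_map, Finset.mem_Iic, hj]
    constructor
    · rintro ⟨⟨k, rfl⟩, hk⟩
      exact ⟨k, e.le_iff_le.1 hk, rfl⟩
    · rintro ⟨k, hk, rfl⟩
      exact ⟨⟨k, rfl⟩, e.le_iff_le.2 hk⟩
  rw [hfilter, Finset.card_map, Fin.card_Iic]
  exact Nat.sub_add_cancel hm

/-- Among the elements above the first third, keep those on which `q` has its majority value, and
choose the test with the opposite outcome on the first third. -/
theorem shatters_of_thresholds {ι τ : Type*} [LinearOrder ι] {R : ι → τ → Prop}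
    (h : ∀ t, ∃ q : ι → Prop, ∀ b : Prop, ∃ y, (∀ j ≤ t, R j y ↔ b) ∧ ∀ j > t, R j y ↔ q j)
    {d : ℕ} {D : Finset ι} (hD : 3 ^ d ≤ D.card) : Shatters R d D := by
  classical
  induction d generalizing D with
  | zero => exact Finset.card_pos.1 hD
  | succ d ih =>
    obtain ⟨t, ht⟩ := exists_card_filter_le_eq (m := 3 ^ d) (by positivity)
      ((Nat.pow_le_pow_right three_pos d.le_succ).trans hD)
    obtain ⟨q, hq⟩ := h t
    let U := {j ∈ D | ¬j ≤ t}
    have hU : 2 * 3 ^ d ≤ U.card := by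
      have : {j ∈ D | j ≤ t}.card + U.card = D.card := D.card_filter_add_card_filter_not _
      rw [pow_succ'] at hD
      omega
    obtain ⟨c, hc⟩ : ∃ c : Prop, 3 ^ d ≤ {j ∈ U | q j ↔ c}.card := by
      by_contra! hlt
      have htrue := hlt True
      have hfalse := hlt False
      simp only [iff_true, iff_false] at htrue hfalse
      have : {j ∈ U | q j}.card + {j ∈ U | ¬q j}.card = U.card :=
        U.card_filter_add_card_filter_not q
      omega
    obtain ⟨y, hle, hgt⟩ := hq (¬c)
    refine ⟨y, fun b => ?_⟩
    by_cases hb : b ↔ c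
    · refine (ih hc).mono fun j hj => ?_
      obtain ⟨hjU, hjc⟩ := Finset.mem_filter.1 hj
      obtain ⟨hjD, hjt⟩ := Finset.mem_filter.1 hjU
      exact ⟨hjD, by rw [hgt j (not_le.1 hjt), hjc, hb]⟩
    · refine (ih ht.ge).mono fun j hj => ?_
      obtain ⟨hjD, hjt⟩ := Finset.mem_filter.1 hj
      exact ⟨hjD, by rw [hle j hjt]; tauto⟩

variable {α : Type u} {L : Language α}

theorem exists_cons_mem_iff_notMem (hbot : L ≠ ⊥) (htop : L ≠ ⊤) :
    ∃ (a : α) (w : List α), a :: w ∈ L ↔ w ∉ L := by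
  by_contra! h
  have hall : ∀ w : List α, w ∈ L ↔ [] ∈ L := by
    intro w
    induction w with
    | nil => rfl
    | cons a w ih => have := h a w; tauto
  by_cases hnil : [] ∈ L
  · exact htop (Set.eq_univ_of_forall fun w => (hall w).2 hnil)
  · exact hbot (Set.eq_empty_of_forall_notMem fun w hw => hnil ((hall w).1 hw))

/-- Popping `t` letters and pushing `w`, or popping `t + 1` letters and pushing `a :: w`, gives the
same window on the runs of length more than `t`, and the windows `w` and `a :: w` on the others. -/
theorem shatters_replicate {a : α} {w : List α} (haw : a :: w ∈ L ↔ w ∉ L) {d : ℕ} {D : Finset ℕ}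
    (hD : 3 ^ d ≤ D.card) :
    Shatters (windowTest L) d ((fun j => List.replicate j a) '' (D : Set ℕ)) := by
  refine (shatters_of_thresholds (R := fun j => windowTest L (List.replicate j a))
    (fun t => ?_) hD).map (Set.mapsTo_image _ _) fun y => ⟨y, fun _ _ => Iff.rfl⟩
  refine ⟨fun j => List.replicate (j - t) a ++ w ∈ L, fun b => ?_⟩
  simp only [windowTest]
  by_cases hb : w ∈ L ↔ b
  · refine ⟨(t, w), fun j hj => ?_, fun j _ => by rw [List.drop_replicate]⟩
    rw [List.drop_replicate, Nat.sub_eq_zero_of_le hj, List.replicate_zero, List.nil_append, hb]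
  · refine ⟨(t + 1, a :: w), fun j hj => ?_, fun j hj => ?_⟩
    · rw [List.drop_replicate, Nat.sub_eq_zero_of_le (Nat.le_succ_of_le hj), List.replicate_zero,
        List.nil_append, haw]
      tauto
    · rw [List.drop_replicate, show j - t = j - (t + 1) + 1 by omega, List.replicate_succ',
        List.append_assoc, List.singleton_append]

theorem randLower_logb (hbot : L ≠ ⊥) (htop : L ≠ ⊤) :
    RandLower.{u, v} L (fun n => Real.logb 2 n) := by
  obtain ⟨a, w, haw⟩ := exists_cons_mem_iff_notMem hbot htop
  refine randLower_of_shatters (c := 1 / 4) (by norm_num) (n₀ := 3) fun n hn =>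
    ⟨Nat.log 4 (n + 1), _, ?_, shatters_replicate haw (D := Finset.range (n + 1)) ?_, ?_⟩
  · rintro _ ⟨j, hj, rfl⟩
    rw [List.length_replicate]
    exact Finset.mem_range_succ_iff.1 hj
  · rw [Finset.card_range]
    exact (Nat.pow_le_pow_left (by norm_num) _).trans (Nat.pow_log_le_self 4 n.succ_ne_zero)
  · have hlog : 1 ≤ Nat.log 4 (n + 1) := Nat.log_pos (by norm_num) (by omega)
    have hpow : n ≤ 2 ^ (2 * (Nat.log 4 (n + 1) + 1)) := by
      rw [pow_mul]
      exact n.le_succ.trans (Nat.lt_pow_succ_log_self (by norm_num) _).le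
    have hlogb : Real.logb 2 n ≤ (2 * (Nat.log 4 (n + 1) + 1) : ℕ) := by
      rw [Real.logb_le_iff_le_rpow one_lt_two (by positivity), Real.rpow_natCast]
      exact_mod_cast hpow
    have hlog' : (1 : ℝ) ≤ Nat.log 4 (n + 1) := by exact_mod_cast hlog
    push_cast at hlogb
    linarith

end Logarithmic

/-! ### Languages that are not well-behaved need linear space -/

section Linear

variable {α : Type u} {σ : Type*} {L K : Language α} {M : DFA α σ}

theorem length_of_mem_pow {r k : ℕ} {w : List α} (hK : ∀ x ∈ K, x.length = r) (hw : w ∈ K ^ k) :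
    w.length = k * r := by
  obtain ⟨l, rfl, rfl, hl⟩ := Language.mem_pow.1 hw
  rw [List.length_flatten, List.map_congr_left fun x hx => hK x (hl x hx), List.map_const',
    List.sum_replicate, smul_eq_mul]

theorem shatters_pow_of_loops {p : σ} {m : ℕ}
    (h : ∀ b : Prop, ∃ x ∈ K, m ≤ x.length ∧ M.evalFrom p x = p ∧
      (M.evalFrom p (x.take m) ∈ M.accept ↔ b)) (k : ℕ) :
    Shatters (fun w i => M.evalFrom p (w.take i) ∈ M.accept) k {w | w ∈ K ^ k} := by
  induction k with
  | zero => exact ⟨[], by simp [Language.mem_one]⟩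
  | succ k ih =>
    refine ⟨m, fun b => ?_⟩
    obtain ⟨x, hxK, hm, hx, hb⟩ := h b
    refine ih.map (f := (x ++ ·)) (fun w hw => ⟨?_, ?_⟩) fun i => ⟨x.length + i, fun w _ => ?_⟩
    · rw [pow_succ']
      exact Language.append_mem_mul hxK hw
    · simpa only [List.take_append_of_le_length hm] using hb
    · rw [List.take_length_add_append, DFA.evalFrom_of_append, hx]

theorem reverse_mem_iff_eval_mem (hM : M.accepts = L.reverse) (w : List α) :
    w.reverse ∈ L ↔ M.eval w ∈ M.accept := by
  rw [← DFA.mem_accepts, hM, Language.mem_reverse]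

theorem Shatters.windowTest_of_reverse (hM : M.accepts = L.reverse) {z : List α} {W : Set (List α)}
    {d N : ℕ} (hW : ∀ w ∈ W, w.length = N)
    (h : Shatters (fun w i => M.evalFrom (M.eval z) (w.take i) ∈ M.accept) d W) :
    Shatters (windowTest L) d ((fun w => (z ++ w).reverse) '' W) := by
  refine h.map (Set.mapsTo_image _ W) fun i => ⟨(N - i, []), fun w hw => ?_⟩
  have htake : (z ++ w).take ((z ++ w).length - (N - i)) = z ++ w.take i := by
    have hN := hW w hw
    rw [List.take_append, List.take_of_length_le (by grind), List.append_cancel_left_eq,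
      List.take_eq_take_iff, List.length_append]
    omega
  rw [windowTest, List.append_nil, List.drop_reverse, htake, reverse_mem_iff_eval_mem hM,
    DFA.eval, DFA.evalFrom_of_append]

theorem randLower_linear_of_loops (hM : M.accepts = L.reverse) {z : List α} {r m : ℕ}
    (hK : ∀ x ∈ K, x.length = r) (hm : m ≤ r)
    (h : ∀ b : Prop, ∃ x ∈ K, M.evalFrom (M.eval z) x = M.eval z ∧
      (M.evalFrom (M.eval z) (x.take m) ∈ M.accept ↔ b)) :
    RandLower.{u, v} L (fun n => n) := by
  have hr : 0 < r := by
    rw [Nat.pos_iff_ne_zero]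
    rintro rfl
    obtain ⟨x, hxK, -, hx⟩ := h True
    obtain ⟨y, hyK, -, hy⟩ := h False
    rw [List.eq_nil_of_length_eq_zero (hK x hxK)] at hx
    rw [List.eq_nil_of_length_eq_zero (hK y hyK)] at hy
    exact hy.1 (hx.2 trivial)
  have hs : ∀ k, Shatters (fun w i => M.evalFrom (M.eval z) (w.take i) ∈ M.accept) k
      {w | w ∈ K ^ k} := shatters_pow_of_loops fun b => by
    obtain ⟨x, hxK, hx⟩ := h b
    exact ⟨x, hxK, hm.trans_eq (hK x hxK).symm, hx⟩
  refine randLower_of_shatters (c := 1 / (z.length + 2 * r)) (by positivity)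
    (n₀ := z.length + r) fun n hn => ⟨(n - z.length) / r, _, ?_,
      (hs _).windowTest_of_reverse hM fun w hw => length_of_mem_pow hK hw, ?_⟩
  · rintro _ ⟨w, hw, rfl⟩
    rw [List.length_reverse, List.length_append, length_of_mem_pow hK hw]
    have := Nat.div_mul_le_self (n - z.length) r
    omega
  · have hone : 1 ≤ (n - z.length) / r := (Nat.one_le_div_iff hr).2 (by omega)
    have hlt : n ≤ z.length + r * ((n - z.length) / r + 1) := by
      have := Nat.lt_mul_div_succ (n - z.length) hr
      omega
    have hle : n ≤ (z.length + 2 * r) * ((n - z.length) / r) := by nlinarith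
    rw [one_div_mul_eq_div, div_le_iff₀' (by positivity)]
    exact_mod_cast hle

/-- Any two words of equal length that can be read from a reachable state without leaving its
strongly connected component are both accepted or both rejected from that state. -/
def IsWellBehaved (M : DFA α σ) : Prop :=
  ∀ z u u' v v' : List α, u.length = v.length →
    M.evalFrom (M.eval z) (u ++ u') = M.eval z → M.evalFrom (M.eval z) (v ++ v') = M.eval z →
      M.evalFrom (M.eval z) u ∈ M.accept → M.evalFrom (M.eval z) v ∈ M.accept

theorem randLower_linear_of_not_isWellBehaved (hM : M.accepts = L.reverse)
    (h : ¬IsWellBehaved M) : RandLower.{u, v} L (fun n => n) := by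
  unfold IsWellBehaved at h
  push Not at h
  obtain ⟨z, u, u', v, v', hlen, hu, hv, hmem, hnotMem⟩ := h
  let x := u ++ (u' ++ (v ++ v'))
  let y := v ++ (v' ++ (u ++ u'))
  have hx : M.evalFrom (M.eval z) x = M.eval z := by
    simp only [x, ← List.append_assoc u, DFA.evalFrom_of_append _ _ (u ++ u'), hu, hv]
  have hy : M.evalFrom (M.eval z) y = M.eval z := by
    simp only [y, ← List.append_assoc v, DFA.evalFrom_of_append _ _ (v ++ v'), hu, hv]
  refine randLower_linear_of_loops (z := z) (K := ({x, y} : Set (List α))) (r := x.length)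
    (m := u.length) hM ?_ (by simp [x]) fun b => ?_
  · rintro _ (rfl | rfl)
    · rfl
    · simp only [x, y, List.length_append, hlen]
      omega
  · by_cases hb : b
    · exact ⟨x, Or.inl rfl, hx, by simpa [x, hb] using hmem⟩
    · exact ⟨y, Or.inr rfl, hy, by simpa [y, hb, hlen] using hnotMem⟩

end Linear

/-! ### Deterministic algorithms as randomized algorithms -/

section Deterministic

/-- A deterministic algorithm, seen as a randomized one. -/
noncomputable def toRandAlg {β Q : Type*} (P : DFA β Q) : RandAlg β Q where
  init := PMF.pure P.start
  step q b := PMF.pure (P.step q b)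
  accept := P.accept

theorem toRandAlg_run {β Q : Type*} (P : DFA β Q) (x : List β) :
    (toRandAlg P).run x = PMF.pure (P.eval x) := by
  induction x using List.reverseRecOn with
  | nil => rfl
  | append_singleton x b ih =>
    unfold RandAlg.run at ih ⊢
    rw [List.foldl_append, ih, DFA.eval_append_singleton]
    exact PMF.pure_bind _ _

theorem isFor_toRandAlg {β Q : Type*} (P : DFA β Q) (err : ℝ≥0∞) :
    (toRandAlg P).IsFor P.accepts err := by
  constructor <;> intro x hx
  · rw [toRandAlg_run, PMF.toOuterMeasure_pure_apply, if_pos (by exact hx)]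
    exact tsub_le_self
  · rw [toRandAlg_run, PMF.toOuterMeasure_pure_apply, if_pos (by exact hx)]
    exact tsub_le_self

variable {α : Type u} {L : Language α} {g : ℕ → ℝ}

theorem IsDetSWAlg.isRandSWAlg {Q : Type*} {P : DFA (Option α) Q} (hP : IsDetSWAlg P L) :
    IsRandSWAlg (toRandAlg P) L := by
  have hfor := isFor_toRandAlg P (1 / 3)
  rwa [show P.accepts = SW L from hP] at hfor

theorem randSpace_toRandAlg {Q : Type*} (P : DFA (Option α) Q) :
    randSpace (toRandAlg P) = detSpace P := by
  funext n
  simp only [randSpace, detSpace, toRandAlg_run, PMF.support_pure, Set.mem_singleton_iff]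

theorem RandLower.detLower (h : RandLower.{u, v} L g) : DetLower.{u, v} L g := by
  obtain ⟨c, hc, n₀, h⟩ := h
  refine ⟨c, hc, n₀, fun Q P hP n hn => ?_⟩
  rw [← randSpace_toRandAlg]
  exact h Q _ hP.isRandSWAlg n hn

theorem DetUpper.randUpper (h : DetUpper L g) : RandUpper L g := by
  obtain ⟨Q, P, hP, hO⟩ := h
  exact ⟨Q, toRandAlg P, hP.isRandSWAlg, by rwa [randSpace_toRandAlg]⟩

end Deterministic

/-! ### Upper bounds from invariants of the window -/

section Upper

variable {α : Type u} {T : Type*} {L L' K : Language α}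

/-- A map `φ` on windows is a window invariant for `L` if `φ w` retains enough of the window `w` to
decide membership in `L` and to be updated. The values of `φ` then serve as memory states of a
deterministic algorithm for `L`. -/
structure IsWindowInvariant (L : Language α) (φ : List α → T) : Prop where
  mem_iff : ∀ {w w'}, φ w = φ w' → (w ∈ L ↔ w' ∈ L)
  windowStep_eq : ∀ {w w'} b, φ w = φ w' → φ (windowStep w b) = φ (windowStep w' b)

theorem IsWindowInvariant.foldl_mem_iff {φ : List α → T} (h : IsWindowInvariant L φ)
    (y : List (Option α)) {w w' : List α} (hw : φ w = φ w') :
    y.foldl windowStep w ∈ L ↔ y.foldl windowStep w' ∈ L := by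
  induction y generalizing w w' with
  | nil => exact h.mem_iff hw
  | cons b _ ih => exact ih (h.windowStep_eq b hw)

theorem bits_le {Q : Type*} {S : Set Q} {N : ℕ} (hN : S.encard ≤ N) :
    bits S ≤ ENNReal.ofReal (Real.logb 2 N) := by
  have hS : S.Finite := Set.finite_of_encard_le_coe hN
  have hcard : S.ncard ≤ N := by rwa [← hS.cast_ncard_eq, Nat.cast_le] at hN
  rw [bits, if_pos hS]
  refine ENNReal.ofReal_le_ofReal ?_
  rcases Nat.eq_zero_or_pos S.ncard with h | h
  · rw [h, Nat.cast_zero, Real.logb_zero]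
    exact div_nonneg (Real.log_natCast_nonneg _) (Real.log_nonneg one_le_two)
  · exact Real.logb_le_logb_of_le one_lt_two (by exact_mod_cast h) (by exact_mod_cast hcard)

theorem coe_eval_toDFA {β : Type*} (K : Language β) (x : List β) :
    (K.toDFA.eval x : Language β) = K.leftQuotient x := by
  induction x using List.reverseRecOn with
  | nil => rfl
  | append_singleton x b ih =>
    rw [DFA.eval_append_singleton, Language.step_toDFA, ih, Language.leftQuotient_append]

theorem IsWindowInvariant.eval_toDFA_factorsThrough {φ : List α → T}
    (h : IsWindowInvariant L φ) :
    Function.FactorsThrough (SW L).toDFA.eval fun x => φ (window x) := by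
  intro x x' hx
  refine Subtype.ext ?_
  rw [coe_eval_toDFA, coe_eval_toDFA]
  ext y
  change window (x ++ y) ∈ L ↔ window (x' ++ y) ∈ L
  rw [window_append, window_append]
  exact h.foldl_mem_iff y hx

theorem IsWindowInvariant.detUpper {φ : List α → T} (h : IsWindowInvariant L φ) {N : ℕ → ℕ}
    (hN : ∀ n, (φ '' {w | w.length ≤ n}).encard ≤ N n) {g : ℕ → ℝ} {C : ℝ} (hC : 0 < C)
    {n₀ : ℕ} (hg : ∀ n ≥ n₀, Real.logb 2 (N n) ≤ C * g n) : DetUpper L g := by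
  refine ⟨_, (SW L).toDFA, (SW L).accepts_toDFA, C, hC, n₀, fun n hn => ?_⟩
  let ψ := Function.extend (fun x => φ (window x)) (SW L).toDFA.eval
    fun _ => (SW L).toDFA.start
  have hsub : {q | ∃ x, maxWindowLength x ≤ n ∧ q = (SW L).toDFA.eval x} ⊆
      ψ '' (φ '' {w | w.length ≤ n}) := by
    rintro _ ⟨x, hx, rfl⟩
    exact ⟨_, ⟨_, (length_window_le x).trans hx, rfl⟩,
      h.eval_toDFA_factorsThrough.extend_apply _ x⟩
  have hcard := (Set.encard_le_encard hsub).trans ((Set.encard_image_le _ _).trans (hN n))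
  exact (bits_le hcard).trans (ENNReal.ofReal_le_ofReal (hg n hn))

theorem detUpper_const (hL : L = ⊥ ∨ L = ⊤) : DetUpper L fun _ => 1 := by
  have h : IsWindowInvariant L fun _ => () := by
    refine ⟨fun _ => ?_, fun _ _ => rfl⟩
    rcases hL with rfl | rfl
    · exact iff_of_false id id
    · exact iff_of_true trivial trivial
  refine h.detUpper (N := fun _ => 1) (C := 1) (n₀ := 0) (fun n => ?_) one_pos fun n _ => by simp
  exact_mod_cast Set.encard_le_one_iff.2 fun _ _ _ _ => rfl

theorem encard_length_le (β : Type*) [Finite β] (n : ℕ) :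
    {w : List β | w.length ≤ n}.encard ≤ ((Nat.card β + 1) ^ n : ℕ) := by
  have hinj : Set.InjOn (fun (w : List β) (i : Fin n) => w[(i : ℕ)]?) {w | w.length ≤ n} := by
    intro w hw w' hw' h
    refine List.ext_getElem? fun i => ?_
    rcases lt_or_ge i n with hi | hi
    · exact congrFun h ⟨i, hi⟩
    · rw [List.getElem?_eq_none (le_trans hw hi), List.getElem?_eq_none (le_trans hw' hi)]
  refine (Set.encard_le_encard_of_injOn (Set.mapsTo_univ _ _) hinj).trans_eq ?_
  rw [Set.encard_univ, ENat.card_eq_coe_natCard, Nat.card_fun, Finite.card_option, Nat.card_fin]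

theorem isWindowInvariant_map_step {σ : Type*} (M : DFA α σ) :
    IsWindowInvariant M.accepts fun w => w.map fun a q => M.step q a := by
  refine ⟨fun {w w'} h => ?_, fun {w w'} b h => ?_⟩
  · have hfold : ∀ w : List α,
        M.eval w = (w.map fun a q => M.step q a).foldl (fun q f => f q) M.start := fun w => by
      rw [List.foldl_map]
      rfl
    rw [DFA.mem_accepts, DFA.mem_accepts, hfold, hfold, h]
  · cases b with
    | some a => simp only [windowStep, List.map_append, h]
    | none => simp only [windowStep, List.map_tail, h]

theorem detUpper_linear (hL : L.IsRegular) : DetUpper L fun n => n := by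
  obtain ⟨σ, _, M, rfl⟩ := hL
  have : Nonempty (σ → σ) := ⟨id⟩
  refine (isWindowInvariant_map_step M).detUpper (N := fun n => (Nat.card (σ → σ) + 1) ^ n)
    (C := Real.logb 2 (Nat.card (σ → σ) + 1 : ℕ)) (n₀ := 0) (fun n => ?_)
    (Real.logb_pos one_lt_two ?_) fun n _ => ?_
  · refine (Set.encard_le_encard ?_).trans (encard_length_le (σ → σ) n)
    rintro _ ⟨w, hw, rfl⟩
    simpa using hw
  · exact_mod_cast Nat.succ_lt_succ (Nat.card_pos (α := σ → σ))
  · push_cast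
    rw [Real.logb_pow, mul_comm]

/-- `L` has a window invariant that takes polynomially many values on the windows of length at most
`n`. The base `n + 2` counts the lengths up to `n` and infinity. -/
def HasPolynomialInvariant (L : Language α) : Prop :=
  ∃ (T : Type) (φ : List α → T), IsWindowInvariant L φ ∧
    ∃ C : ℕ, ∀ n, (φ '' {w | w.length ≤ n}).encard ≤ ((n + 2) ^ C : ℕ)

theorem HasPolynomialInvariant.detUpper (h : HasPolynomialInvariant L) :
    DetUpper L fun n => Real.logb 2 n := by
  obtain ⟨T, φ, hφ, C, hC⟩ := h
  refine hφ.detUpper hC (C := 2 * C + 1) (n₀ := 2) (by positivity) fun n hn => ?_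
  have htwo : (2 : ℝ) ≤ n := by exact_mod_cast hn
  have hlog : Real.logb 2 (n + 2) ≤ 2 * Real.logb 2 n := by
    rw [← Nat.cast_two (R := ℝ), ← Real.logb_pow, Nat.cast_two]
    exact Real.logb_le_logb_of_le one_lt_two (by positivity) (by nlinarith)
  have hnonneg : 0 ≤ Real.logb 2 (n : ℝ) := Real.logb_nonneg one_lt_two (by linarith)
  push_cast
  rw [Real.logb_pow]
  nlinarith [Nat.cast_nonneg (α := ℝ) C]

theorem HasPolynomialInvariant.compl (h : HasPolynomialInvariant L) :
    HasPolynomialInvariant Lᶜ := by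
  obtain ⟨T, φ, hφ, hC⟩ := h
  exact ⟨T, φ, ⟨fun hw => not_congr (hφ.mem_iff hw), hφ.windowStep_eq⟩, hC⟩

theorem HasPolynomialInvariant.sup (h : HasPolynomialInvariant L)
    (h' : HasPolynomialInvariant L') : HasPolynomialInvariant (L ⊔ L') := by
  obtain ⟨T, φ, hφ, C, hC⟩ := h
  obtain ⟨T', φ', hφ', C', hC'⟩ := h'
  refine ⟨T × T', fun w => (φ w, φ' w), ⟨fun hw => ?_, fun b hw => ?_⟩, C + C', fun n => ?_⟩
  · exact or_congr (hφ.mem_iff (Prod.ext_iff.1 hw).1) (hφ'.mem_iff (Prod.ext_iff.1 hw).2)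
  · exact Prod.ext (hφ.windowStep_eq b (Prod.ext_iff.1 hw).1)
      (hφ'.windowStep_eq b (Prod.ext_iff.1 hw).2)
  · have hsub : (fun w => (φ w, φ' w)) '' {w | w.length ≤ n} ⊆
        (φ '' {w | w.length ≤ n}) ×ˢ (φ' '' {w | w.length ≤ n}) := by
      rintro _ ⟨w, hw, rfl⟩
      exact ⟨⟨w, hw, rfl⟩, ⟨w, hw, rfl⟩⟩
    refine (Set.encard_le_encard hsub).trans ?_
    rw [Set.encard_prod, pow_add, Nat.cast_mul]
    exact mul_le_mul' (hC n) (hC' n)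

theorem hasPolynomialInvariant_bot : HasPolynomialInvariant (⊥ : Language α) :=
  ⟨Unit, fun _ => (), ⟨fun _ => Iff.rfl, fun _ _ => rfl⟩, 0, fun _ => by
    exact_mod_cast Set.encard_le_one_iff.2 fun _ _ _ _ => rfl⟩

theorem length_windowStep_eq {w w' : List α} (h : w.length = w'.length) (b : Option α) :
    (windowStep w b).length = (windowStep w' b).length := by
  cases b <;> simp [windowStep, h]

theorem encard_Iic (n : ℕ) : (Set.Iic n).encard = (n + 1 : ℕ) := by
  rw [← Finset.coe_Iic, Set.encard_coe_eq_coe_finsetCard, Nat.card_Iic]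

theorem encard_image_length_le (n : ℕ) :
    (List.length '' {w : List α | w.length ≤ n}).encard ≤ (n + 2 : ℕ) :=
  calc (List.length '' {w : List α | w.length ≤ n}).encard
    _ ≤ (Set.Iic n).encard := Set.encard_le_encard (Set.image_subset_iff.2 fun _ => id)
    _ = (n + 1 : ℕ) := encard_Iic n
    _ ≤ (n + 2 : ℕ) := by exact_mod_cast Nat.le_succ _

theorem hasPolynomialInvariant_of_mem_Len (hL : L ∈ Len α) : HasPolynomialInvariant L := by
  refine ⟨ℕ, List.length, ⟨fun {w w'} hw => ?_, fun b hw => length_windowStep_eq hw b⟩, 1,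
    fun n => by simpa only [pow_one] using encard_image_length_le n⟩
  rcases hL.2 w.length with h | h
  · exact iff_of_true (h w rfl) (h w' hw.symm)
  · exact iff_of_false (h w rfl) (h w' hw.symm)

theorem mem_top_mul_iff {w : List α} : w ∈ ⊤ * K ↔ ∃ s, s <:+ w ∧ s ∈ K := by
  rw [Language.mem_mul]
  constructor
  · rintro ⟨a, -, s, hs, rfl⟩
    exact ⟨s, List.suffix_append _ _, hs⟩
  · rintro ⟨s, ⟨a, rfl⟩, hs⟩
    exact ⟨a, trivial, s, hs, rfl⟩

end Upper

/-! ### Left ideals -/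

section LeftIdeal

variable {α : Type u} {σ : Type*} (M : DFA α σ)

/-- The length of the shortest suffix of `w` that leads `M` from its start state to `q`, and `⊤` if
there is none. Pushing a letter onto `w` or popping one updates these lengths without access to
`w`. -/
noncomputable def shortestSuffix (w : List α) (q : σ) : ℕ∞ :=
  ⨅ s ∈ {s | s <:+ w ∧ M.eval s = q}, (s.length : ℕ∞)

variable {M} {w : List α} {q : σ} {n : ℕ}

theorem shortestSuffix_le_iff {k : ℕ} :
    shortestSuffix M w q ≤ k ↔ ∃ s, s <:+ w ∧ s.length ≤ k ∧ M.eval s = q := by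
  constructor
  · intro h
    have hlt := (ENat.lt_add_one_iff (ENat.natCast_ne_top k)).2 h
    simp only [shortestSuffix, iInf_lt_iff] at hlt
    obtain ⟨s, ⟨hs, hq⟩, hlen⟩ := hlt
    exact ⟨s, hs, by exact_mod_cast (ENat.lt_add_one_iff (ENat.natCast_ne_top k)).1 hlen, hq⟩
  · rintro ⟨s, hs, hlen, hq⟩
    exact (iInf₂_le s ⟨hs, hq⟩).trans (by exact_mod_cast hlen)

theorem shortestSuffix_append_singleton_le_iff {a : α} {k : ℕ} :
    shortestSuffix M (w ++ [a]) q ≤ k ↔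
      M.start = q ∨ ∃ p, M.step p a = q ∧ ∃ j < k, shortestSuffix M w p ≤ j := by
  simp only [shortestSuffix_le_iff, List.suffix_concat_iff]
  constructor
  · rintro ⟨_, rfl | ⟨s, rfl, hs⟩, hlen, hq⟩
    · exact Or.inl hq
    · rw [List.length_append, List.length_singleton] at hlen
      rw [DFA.eval_append_singleton] at hq
      exact Or.inr ⟨_, hq, s.length, hlen, s, hs, le_rfl, rfl⟩
  · rintro (hq | ⟨_, hq, j, hj, s, hs, hlen, rfl⟩)
    · exact ⟨[], Or.inl rfl, Nat.zero_le k, hq⟩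
    · refine ⟨s ++ [a], Or.inr ⟨s, rfl, hs⟩, ?_, by rwa [DFA.eval_append_singleton]⟩
      rw [List.length_append, List.length_singleton]
      omega

theorem suffix_tail_iff {s w : List α} : s <:+ w.tail ↔ s <:+ w ∧ s.length ≤ w.length - 1 := by
  cases w with
  | nil => simp
  | cons a w =>
    constructor
    · exact fun h => ⟨h.trans (List.suffix_cons a w), h.length_le⟩
    · rintro ⟨h, hlen⟩
      refine (List.suffix_cons_iff.1 h).resolve_left fun hs => ?_
      rw [hs] at hlen
      exact Nat.not_succ_le_self _ hlen

theorem shortestSuffix_tail_le_iff {k : ℕ} :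
    shortestSuffix M w.tail q ≤ k ↔ shortestSuffix M w q ≤ (min k (w.length - 1) : ℕ) := by
  simp only [shortestSuffix_le_iff, suffix_tail_iff, le_min_iff]
  exact exists_congr fun s => by tauto

theorem mem_top_mul_accepts_iff :
    w ∈ ⊤ * M.accepts ↔ ∃ q ∈ M.accept, shortestSuffix M w q ≤ w.length := by
  simp only [mem_top_mul_iff, shortestSuffix_le_iff, DFA.mem_accepts]
  constructor
  · rintro ⟨s, hs, hmem⟩
    exact ⟨_, hmem, s, hs, hs.length_le, rfl⟩
  · rintro ⟨_, hmem, s, hs, -, rfl⟩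
    exact ⟨s, hs, hmem⟩

theorem shortestSuffix_mem_of_length_le (h : w.length ≤ n) :
    shortestSuffix M w q ∈ insert ⊤ ((↑) '' Set.Iic n : Set ℕ∞) := by
  refine or_iff_not_imp_left.2 fun hne => ?_
  obtain ⟨k, hk⟩ := ENat.ne_top_iff_exists.1 hne
  obtain ⟨s, hs, -, hq⟩ := shortestSuffix_le_iff.1 hk.ge
  refine ⟨k, ?_, hk⟩
  have hks : (k : ℕ∞) ≤ s.length := hk.le.trans (shortestSuffix_le_iff.2 ⟨s, hs, le_rfl, hq⟩)
  exact (Nat.cast_le.1 hks).trans (hs.length_le.trans h)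

theorem encard_insert_top_image_Iic_le (n : ℕ) :
    (insert ⊤ ((↑) '' Set.Iic n : Set ℕ∞)).encard ≤ (n + 2 : ℕ) := by
  grw [Set.encard_insert_le, Set.encard_image_le, encard_Iic]
  norm_cast

theorem isWindowInvariant_shortestSuffix (M : DFA α σ) :
    IsWindowInvariant (⊤ * M.accepts) fun w => (w.length, shortestSuffix M w) := by
  refine ⟨fun hw => ?_, fun {w w'} b hw => ?_⟩
  · obtain ⟨hlen, hsuf⟩ := Prod.mk.inj hw
    rw [mem_top_mul_accepts_iff, mem_top_mul_accepts_iff, hlen, hsuf]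
  · obtain ⟨hlen, hsuf⟩ := Prod.mk.inj hw
    refine Prod.ext (length_windowStep_eq hlen b) (funext fun q => eq_of_forall_ge_iff fun k => ?_)
    cases k with
    | top => simp only [le_top]
    | coe k =>
      cases b with
      | some a => simp only [windowStep, shortestSuffix_append_singleton_le_iff, hsuf]
      | none => simp only [windowStep, shortestSuffix_tail_le_iff, hlen, hsuf]

theorem hasPolynomialInvariant_of_mem_LI {L : Language α} (hL : L ∈ LI α) :
    HasPolynomialInvariant L := by
  obtain ⟨_, ⟨σ, _, M, rfl⟩, rfl⟩ := hL
  refine ⟨_, _, isWindowInvariant_shortestSuffix M, Fintype.card σ + 1, fun n => ?_⟩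
  have hsub : (fun w => (w.length, shortestSuffix M w)) '' {w | w.length ≤ n} ⊆
      (List.length '' {w : List α | w.length ≤ n}) ×ˢ
        Set.univ.pi fun _ : σ => insert ⊤ ((↑) '' Set.Iic n : Set ℕ∞) := by
    rintro _ ⟨w, hw, rfl⟩
    exact ⟨⟨w, hw, rfl⟩, fun q _ => shortestSuffix_mem_of_length_le hw⟩
  refine (Set.encard_le_encard hsub).trans ?_
  rw [Set.encard_prod, Set.encard_pi_eq_prod_encard, Finset.prod_const, Finset.card_univ, pow_succ',
    Nat.cast_mul, Nat.cast_pow]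
  gcongr
  · exact encard_image_length_le n
  · exact encard_insert_top_image_Iic_le n

theorem hasPolynomialInvariant_of_mem_LILen {L : Language α} (hL : L ∈ LILen α) :
    HasPolynomialInvariant L := by
  induction hL using BooleanSubalgebra.closure_bot_sup_induction with
  | mem L hL => exact hL.elim hasPolynomialInvariant_of_mem_LI hasPolynomialInvariant_of_mem_Len
  | bot => exact hasPolynomialInvariant_bot
  | sup L _ L' _ h h' => exact h.sup h'
  | compl L _ h => exact h.compl

end LeftIdeal

/-! ### Well-behaved languages are Boolean combinations of left ideals and length languages -/

section Decomposition

variable {α : Type u}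

theorem evalFrom_flatten_replicate {σ : Type*} {M : DFA α σ} {p : σ} {t : List α}
    (ht : M.evalFrom p t = p) (k : ℕ) : M.evalFrom p (List.replicate k t).flatten = p := by
  induction k with
  | zero => rfl
  | succ k ih => rw [List.replicate_succ, List.flatten_cons, DFA.evalFrom_of_append, ht, ih]

theorem exists_common_loop_length {σ : Type*} [Finite σ] (M : DFA α σ) :
    ∃ N ≠ 0, ∀ p, (∃ t ≠ [], M.evalFrom p t = p) →
      ∀ n, N ∣ n → ∃ t, t.length = n ∧ M.evalFrom p t = p := by
  have := Fintype.ofFinite σ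
  have h : ∀ p, ∃ r ≠ 0, (∃ t ≠ [], M.evalFrom p t = p) →
      ∃ t, t.length = r ∧ M.evalFrom p t = p := by
    intro p
    by_cases hp : ∃ t ≠ [], M.evalFrom p t = p
    · obtain ⟨t, ht, htp⟩ := hp
      exact ⟨t.length, mt List.length_eq_zero_iff.1 ht, fun _ => ⟨t, rfl, htp⟩⟩
    · exact ⟨1, one_ne_zero, fun h => absurd h hp⟩
  choose r hr hloop using h
  refine ⟨∏ p, r p, Finset.prod_ne_zero_iff.2 fun p _ => hr p, fun p hp n hn => ?_⟩
  obtain ⟨t, ht, htp⟩ := hloop p hp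
  obtain ⟨k, hk⟩ := (Finset.dvd_prod_of_mem r (Finset.mem_univ p)).trans hn
  exact ⟨(List.replicate k t).flatten, by simp [hk, ht, mul_comm],
    evalFrom_flatten_replicate htp k⟩

/-- The words of length congruent to `i` modulo `N`. -/
def lengthClass (α : Type u) (N : ℕ) (i : ZMod N) : Language α :=
  {w : List α | (w.length : ZMod N) = i}

/-- The words whose reversal leads `M` into a state of `A`. -/
def reaching {σ : Type*} (M : DFA α σ) (A : Set σ) : Language α :=
  {w : List α | M.eval w.reverse ∈ A}

theorem eval_reverse_append {σ : Type*} (M : DFA α σ) (a y : List α) :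
    M.eval (a ++ y).reverse = M.evalFrom (M.eval y.reverse) a.reverse := by
  rw [List.reverse_append]
  exact M.evalFrom_of_append _ _ _

theorem isRegular_reaching {σ : Type} [Finite σ] (M : DFA α σ) (A : Set σ) :
    (reaching M A).IsRegular :=
  have hreg : Language.IsRegular {w : List α | M.eval w ∈ A} :=
    ⟨σ, Fintype.ofFinite σ, ⟨M.step, M.start, A⟩, rfl⟩
  hreg.reverse

theorem isRegular_lengthClass {N : ℕ} [NeZero N] (i : ZMod N) :
    (lengthClass α N i).IsRegular := by
  let M : DFA α (ZMod N) := ⟨fun s _ => s + 1, 0, {i}⟩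
  refine ⟨ZMod N, inferInstance, M, ?_⟩
  have heval : ∀ w, M.eval w = w.length := by
    intro w
    induction w using List.reverseRecOn with
    | nil => simp [M]
    | append_singleton w a ih =>
      rw [DFA.eval_append_singleton, ih, List.length_append, Nat.cast_add]
      simp [M]
  ext w
  rw [DFA.mem_accepts, heval]
  rfl

theorem lengthClass_mem_LILen {N : ℕ} [NeZero N] (i : ZMod N) : lengthClass α N i ∈ LILen α := by
  refine BooleanSubalgebra.subset_closure (Or.inr ⟨isRegular_lengthClass i, fun n => ?_⟩)
  by_cases h : (n : ZMod N) = i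
  · exact Or.inl fun w hw => by subst hw; exact h
  · exact Or.inr fun w hw => by subst hw; exact h

theorem top_mul_mem_LILen {K : Language α} (hK : K.IsRegular) : ⊤ * K ∈ LILen α :=
  BooleanSubalgebra.subset_closure (Or.inl ⟨K, hK, rfl⟩)

theorem reaching_mem_LILen {σ : Type} [Finite σ] {M : DFA α σ} {A : Set σ}
    (hA : ∀ q ∈ A, ∀ w, M.evalFrom q w ∈ A) : reaching M A ∈ LILen α := by
  have htop : reaching M A = ⊤ * reaching M A := by
    refine le_antisymm (fun w hw => ⟨[], trivial, w, hw, rfl⟩) ?_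
    rintro _ ⟨a, -, y, hy, rfl⟩
    change M.eval (a ++ y).reverse ∈ A
    rw [eval_reverse_append]
    exact hA _ hy _
  rw [htop]
  exact top_mul_mem_LILen (isRegular_reaching M A)

/-- The words whose reversal leads `M` into the strongly connected component of `p`, after visiting
`p` at a prefix whose length is congruent modulo `N` to the length `i` of the whole word. -/
def visiting {σ : Type*} (M : DFA α σ) {N : ℕ} (p : σ) (i : ZMod N) : Language α :=
  ⊤ * (reaching M {p} ⊓ lengthClass α N i) ⊓ (reaching M {q | ∀ v, M.evalFrom q v ≠ p})ᶜ ⊓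
    lengthClass α N i

theorem visiting_mem_LILen {σ : Type} [Finite σ] (M : DFA α σ) {N : ℕ} [NeZero N] (p : σ)
    (i : ZMod N) : visiting M p i ∈ LILen α := by
  have hvisit := top_mul_mem_LILen ((isRegular_reaching M {p}).inf (isRegular_lengthClass i))
  have hleave : reaching M {q | ∀ v, M.evalFrom q v ≠ p} ∈ LILen α := by
    refine reaching_mem_LILen fun q hq w v => ?_
    rw [← DFA.evalFrom_of_append]
    exact hq _
  exact BooleanSubalgebra.inf_mem (BooleanSubalgebra.inf_mem hvisit
    (BooleanSubalgebra.compl_mem hleave)) (lengthClass_mem_LILen i)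

theorem mem_visiting_self {σ : Type*} (M : DFA α σ) (N : ℕ) (w : List α) :
    w ∈ visiting M (M.eval w.reverse) (w.length : ZMod N) :=
  ⟨⟨⟨[], trivial, w, ⟨rfl, rfl⟩, rfl⟩, fun h => h [] rfl⟩, rfl⟩

theorem exists_of_mem_visiting {σ : Type*} {M : DFA α σ} {N : ℕ} {p : σ} {i : ZMod N}
    {w : List α} (hw : w ∈ visiting M p i) :
    ∃ a y v, w = a ++ y ∧ M.eval y.reverse = p ∧ N ∣ a.length ∧
      M.evalFrom p (a.reverse ++ v) = p := by
  obtain ⟨⟨⟨a, -, y, ⟨hy, hyi⟩, rfl⟩, hstay⟩, hi⟩ := hw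
  have hy : M.eval y.reverse = p := hy
  obtain ⟨v, hv⟩ : ∃ v, M.evalFrom (M.eval (a ++ y).reverse) v = p := by
    by_contra! h
    exact hstay h
  refine ⟨a, y, v, rfl, hy, ?_, ?_⟩
  · have hi : ((a ++ y).length : ZMod N) = y.length := Eq.trans hi hyi.symm
    rw [List.length_append, Nat.cast_add, add_eq_right] at hi
    exact (CharP.cast_eq_zero_iff (ZMod N) N _).1 hi
  · rwa [eval_reverse_append, hy, ← DFA.evalFrom_of_append] at hv

/-- A well-behaved automaton accepts along a path within a component if it accepts along a loop of
the same length, and such a loop exists because its length may be any multiple of `N`. -/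
theorem IsWellBehaved.evalFrom_mem {σ : Type*} {M : DFA α σ} (h : IsWellBehaved M) {N : ℕ}
    (hloop : ∀ p, (∃ t ≠ [], M.evalFrom p t = p) →
      ∀ n, N ∣ n → ∃ t, t.length = n ∧ M.evalFrom p t = p)
    {z u v : List α} (hz : M.eval z ∈ M.accept) (hu : N ∣ u.length)
    (huv : M.evalFrom (M.eval z) (u ++ v) = M.eval z) :
    M.evalFrom (M.eval z) u ∈ M.accept := by
  rcases eq_or_ne u [] with rfl | hne
  · exact hz
  obtain ⟨t, ht, htz⟩ := hloop _ ⟨u ++ v, List.append_ne_nil_of_left_ne_nil hne v, huv⟩ _ hu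
  exact h z t [] u v ht (by rwa [List.append_nil]) huv (by rwa [htz])

theorem mem_LILen_of_isWellBehaved {σ : Type} [Finite σ] {L : Language α} {M : DFA α σ}
    (hM : M.accepts = L.reverse) (h : IsWellBehaved M) : L ∈ LILen α := by
  classical
  have := Fintype.ofFinite σ
  obtain ⟨N, hN, hloop⟩ := exists_common_loop_length M
  have : NeZero N := ⟨hN⟩
  have hmem : ∀ w, w ∈ L ↔ M.eval w.reverse ∈ M.accept := fun w => by
    rw [← reverse_mem_iff_eval_mem hM, List.reverse_reverse]
  have hL : L = (Finset.univ.filter fun c : σ × ZMod N => c.1 ∈ M.accept).sup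
      fun c => visiting M c.1 c.2 := by
    refine le_antisymm (fun w hw => ?_) (Finset.sup_le ?_)
    · have hc : (M.eval w.reverse, (w.length : ZMod N)) ∈
          Finset.univ.filter fun c : σ × ZMod N => c.1 ∈ M.accept := by
        simpa using (hmem w).1 hw
      exact Finset.le_sup (f := fun c => visiting M c.1 c.2) hc (mem_visiting_self M N w)
    · rintro ⟨p, i⟩ hp w hw
      obtain ⟨a, y, v, rfl, rfl, ha, hav⟩ := exists_of_mem_visiting hw
      refine (hmem _).2 ?_
      rw [eval_reverse_append]
      exact h.evalFrom_mem hloop (Finset.mem_filter.1 hp).2 (by rwa [List.length_reverse]) hav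
  rw [hL]
  exact Finset.sup_mem (LILen α) BooleanSubalgebra.bot_mem
    (fun x hx y hy => BooleanSubalgebra.sup_mem hx hy) _ _ fun c _ => visiting_mem_LILen M _ _

theorem randLower_linear_of_notMem_LILen {L : Language α} (hreg : L.IsRegular)
    (hL : L ∉ LILen α) : RandLower.{u, v} L (fun n => n) := by
  obtain ⟨σ, _, M, hM⟩ := hreg.reverse
  exact randLower_linear_of_not_isWellBehaved hM (mt (mem_LILen_of_isWellBehaved hM) hL)

end Decomposition

end SlidingWindow

theorem mainTheorem8_general {α : Type u} (L : Language α) :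
    (L ≠ ⊥ → L ≠ ⊤ → SlidingWindow.RandLower.{u, v} L (fun n => Real.logb 2 n)) ∧
    (L.IsRegular →
      ((L = ⊥ ∨ L = ⊤) →
        SlidingWindow.RandUpper L (fun _ => 1) ∧ SlidingWindow.DetUpper L (fun _ => 1)) ∧
      (L ≠ ⊥ → L ≠ ⊤ → L ∈ SlidingWindow.LILen α →
        (SlidingWindow.RandUpper L (fun n => Real.logb 2 n) ∧
          SlidingWindow.RandLower.{u, v} L (fun n => Real.logb 2 n)) ∧
        (SlidingWindow.DetUpper L (fun n => Real.logb 2 n) ∧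
          SlidingWindow.DetLower.{u, v} L (fun n => Real.logb 2 n))) ∧
      (L ∉ SlidingWindow.LILen α →
        (SlidingWindow.RandUpper L (fun n => n) ∧
          SlidingWindow.RandLower.{u, v} L (fun n => n)) ∧
        (SlidingWindow.DetUpper L (fun n => n) ∧
          SlidingWindow.DetLower.{u, v} L (fun n => n)))) := by
  open SlidingWindow in
  refine ⟨randLower_logb, fun hreg => ⟨fun hL => ?_, fun hbot htop hL => ?_, fun hL => ?_⟩⟩
  · exact ⟨(detUpper_const hL).randUpper, detUpper_const hL⟩
  · have hup := (hasPolynomialInvariant_of_mem_LILen hL).detUpper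
    have hlow := randLower_logb.{u, v} hbot htop
    exact ⟨⟨hup.randUpper, hlow⟩, hup, hlow.detLower⟩
  · have hup := detUpper_linear hreg
    have hlow := randLower_linear_of_notMem_LILen.{u, v} hreg hL
    exact ⟨⟨hup.randUpper, hlow⟩, hup, hlow.detLower⟩

theorem mainTheorem8 {α : Type u} [Finite α] [Nonempty α] (L : Language α) :
    -- every language other than `∅` and `Σ*`, regular or not, needs logarithmic space
    (L ≠ ⊥ → L ≠ ⊤ → SlidingWindow.RandLower.{u, v} L (fun n => Real.logb 2 n)) ∧
    -- the trichotomy for regular languages, both randomized and deterministic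
    (L.IsRegular →
      ((L = ⊥ ∨ L = ⊤) →
        SlidingWindow.RandUpper L (fun _ => 1) ∧ SlidingWindow.DetUpper L (fun _ => 1)) ∧
      (L ≠ ⊥ → L ≠ ⊤ → L ∈ SlidingWindow.LILen α →
        (SlidingWindow.RandUpper L (fun n => Real.logb 2 n) ∧
          SlidingWindow.RandLower.{u, v} L (fun n => Real.logb 2 n)) ∧
        (SlidingWindow.DetUpper L (fun n => Real.logb 2 n) ∧
          SlidingWindow.DetLower.{u, v} L (fun n => Real.logb 2 n))) ∧
      (L ∉ SlidingWindow.LILen α →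
        (SlidingWindow.RandUpper L (fun n => n) ∧
          SlidingWindow.RandLower.{u, v} L (fun n => n)) ∧
        (SlidingWindow.DetUpper L (fun n => n) ∧
          SlidingWindow.DetLower.{u, v} L (fun n => n)))) :=
  mainTheorem8_general.{u, v} L
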